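/- Let $G$ be a connected, locally path connected topological group (no separation axiom is assumed). Definitions. A continuous map $p:(\widetilde X,\tilde x_0)\to (X,x_0)$ has the unique lifting property if for every connected, locally path connected pointed space $(Y,y_0)$ and every continuous map $f:(Y,y_0)\to (X,x_0)$ with $f_*\pi_1(Y,y_0)\subseteq p_*\pi_1(\widetilde X,\tilde x_0)$ there is exactly one continuous map $\tilde f:(Y,y_0)\to(\widetilde X,\tilde x_0)$ with $p\circ\tilde f=f$. If $\widetilde G$ is a topological group with identity $\tilde e$ and $p:\widetilde G\to G$ is a continuous homomorphism, then $(\widetilde G,p)$ is a generalized covering group of $G$ if $\widetilde G$ is connected and locally path connected and $p:(\widetilde G,\tilde e)\to(G,e)$ has the unique lifting property. A continuous map $p:E\to X$ is a rigid covering fibration if it is a (Hurewicz) fibration, i.e. has the homotopy lifting property with respect to all topological spaces, and has unique path lifting, i.e. any two paths $\alpha,\beta:[0,1]\to E$ with $\alpha(0)=\beta(0)$ and $p\circ\alpha=p\circ\beta$ are equal. Then the following hold. (i) For every topological group $\widetilde G$ and every continuous homomorphism $p:\widetilde G\to G$, the pair $(\widetilde G,p)$ is a generalized covering group of $G$ if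 and only if $\widetilde G$ is connected and locally path connected and $p$ is a rigid covering fibration. (ii) For every topological space $\widetilde G$ and every continuous map $p:\widetilde G\to G$, there is a group structure on $\widetilde G$ that makes $\widetilde G$ a topological group, $p$ a homomorphism and $(\widetilde G,p)$ a generalized covering group of $G$, if and only if $\widetilde G$ is connected and locally path connected and $p$ is a rigid covering fibration. -/

import Mathlib

open scoped unitInterval

universe u

namespace GenCov

/-- The unique lifting property of `p : (E, e₀) → (X, p e₀)`: for every connected, locally path
connected pointed space `(Y, y₀)`, every continuous `f : (Y, y₀) → (X, p e₀)` with
`f_* π₁(Y, y₀) ⊆ p_* π₁(E, e₀)` has exactly one continuous lift `(Y, y₀) → (E, e₀)`. -/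
def HasUniqueLiftingProperty {E X : Type u} [TopologicalSpace E] [TopologicalSpace X]
    (p : C(E, X)) (e₀ : E) : Prop :=
  ∀ (Y : Type u) [TopologicalSpace Y] [ConnectedSpace Y] [LocallyPathConnectedSpace Y]
    (y₀ : Y) (f : C(Y, X)) (hf : f y₀ = p e₀),
    (FundamentalGroup.mapOfEq f hf).range ≤ (FundamentalGroup.map p e₀).range →
      ∃! g : C(Y, E), g y₀ = e₀ ∧ p.comp g = f

/-- `p : (E, e₀) → (X, p e₀)` is a generalized covering map: `E` is connected and locally path
connected, and `p` has the unique lifting property. -/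
structure IsGeneralizedCovering {E X : Type u} [TopologicalSpace E] [TopologicalSpace X]
    (p : C(E, X)) (e₀ : E) : Prop where
  connected : ConnectedSpace E
  locPathConnected : LocallyPathConnectedSpace E
  uniqueLifting : HasUniqueLiftingProperty p e₀

/-- For topological groups `E`, `G` and a continuous homomorphism `p : E → G`, the pair `(E, p)` is
a generalized covering group of `G` if `p : (E, 1) → (G, 1)` is a generalized covering map. -/
def IsGeneralizedCoveringGroup {E G : Type u} [Group E] [TopologicalSpace E]
    [IsTopologicalGroup E] [Group G] [TopologicalSpace G] [IsTopologicalGroup G]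
    (p : E →ₜ* G) : Prop :=
  IsGeneralizedCovering (p : C(E, G)) 1

/-- A (Hurewicz) fibration: the homotopy lifting property with respect to every space. -/
def IsFibration {E X : Type u} [TopologicalSpace E] [TopologicalSpace X] (p : C(E, X)) : Prop :=
  ∀ (Y : Type u) [TopologicalSpace Y] (f : C(Y, E)) (F : C(I × Y, X)),
    (∀ y, F (0, y) = p (f y)) →
      ∃ L : C(I × Y, E), (∀ y, L (0, y) = f y) ∧ p.comp L = F

/-- Unique path lifting: two paths in `E` with the same initial point and the same projection
to `X` are equal. -/
def HasUniquePathLifting {E X : Type u} [TopologicalSpace E] [TopologicalSpace X]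
    (p : C(E, X)) : Prop :=
  ∀ a b : C(I, E), a 0 = b 0 → p.comp a = p.comp b → a = b

/-- A rigid covering fibration: a fibration with unique path lifting. -/
structure IsRigidCoveringFibration {E X : Type u} [TopologicalSpace E] [TopologicalSpace X]
    (p : C(E, X)) : Prop where
  fibration : IsFibration p
  uniquePathLifting : HasUniquePathLifting p

end GenCov

/-!
The graph of a lift of `f : Y → X` through a rigid covering fibration `p : E → X` is the path
component of `(y₀, e₀)` in the fibre product of `Y` and `E` over `X`. Unique path lifting makes this
component single-valued over `Y` as soon as loops at `y₀` lift to loops at `e₀`, and homotopy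
lifting from the space of paths issuing from a point makes the resulting map continuous. This yields
the unique lifting property, and also group operations on `E`, as lifts of those of the base group.

Conversely, the space of paths from `1` in a topological group `G` is contractible and locally path
connected, so for a generalized covering group `p : E → G` the map `δ ↦ δ 1` on it lifts to `E`.
Translating by elements of `E` turns this single lift into lifts of all homotopies. Path lifts are
unique because the endpoint of a path in `E` from `1` is the value of this lift at its image in `G`.
-/

namespace GenCov

open Filter Topology

/-- The space of paths in `X` that start at `x` and end anywhere, with the compact-open topology. -/
abbrev PathsFrom {X : Type*} [TopologicalSpace X] (x : X) : Type _ := {δ : C(I, X) // δ 0 = x}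

theorem hasBasis_nhds_continuousMap_const {K X : Type*} [TopologicalSpace K] [CompactSpace K]
    [TopologicalSpace X] (x : X) :
    (𝓝 (ContinuousMap.const K x)).HasBasis (· ∈ 𝓝 x) fun U => {δ | ∀ t, δ t ∈ U} :=
  (𝓝 x).basis_sets.nhds_continuousMapConst.to_hasBasis
    (fun ⟨_, U⟩ h => ⟨U, h.2, fun _ hδ t _ => hδ t⟩)
    (fun U hU => ⟨(Set.univ, U), ⟨isCompact_univ, hU⟩, fun _ hδ t => hδ (Set.mem_univ t)⟩)

namespace PathsFrom

section Space

variable {X : Type*} [TopologicalSpace X]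

/-- The constant path, as the base point of the space of paths from `x`. -/
def const (x : X) : PathsFrom x := ⟨.const I x, rfl⟩

@[simp]
theorem const_apply (x : X) (t : I) : (const x).1 t = x := rfl

variable {x : X}

/-- The part of the path `δ` before time `t`, linearly reparametrized by the unit interval. The
initial segments contract the space of paths from `x` to the constant path. -/
def initialSegment (t : I) (δ : PathsFrom x) : PathsFrom x :=
  ⟨δ.1.comp ⟨fun s => s * t, by fun_prop⟩, by simp [δ.2]⟩

@[simp]
theorem initialSegment_apply (t : I) (δ : PathsFrom x) (s : I) :
    (initialSegment t δ).1 s = δ.1 (s * t) := rfl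

@[simp]
theorem initialSegment_zero (δ : PathsFrom x) : initialSegment 0 δ = const x := by
  ext s
  simp [δ.2]

@[simp]
theorem initialSegment_one (δ : PathsFrom x) : initialSegment 1 δ = δ := by
  ext s
  simp

theorem continuous_initialSegment :
    Continuous fun z : I × PathsFrom x => initialSegment z.1 z.2 := by
  refine .subtype_mk (ContinuousMap.continuous_of_continuous_uncurry _ ?_) _
  change Continuous fun z : (I × PathsFrom x) × I => z.1.2.1 (z.2 * z.1.1)
  fun_prop

instance : ContractibleSpace (PathsFrom x) := by
  refine (contractible_iff_id_nullhomotopic _).2 ⟨const x, ⟨ContinuousMap.Homotopy.symm ?_⟩⟩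
  exact ⟨⟨_, continuous_initialSegment⟩, initialSegment_zero, initialSegment_one⟩

theorem map_eval_one_nhds_const [LocallyPathConnectedSpace X] (x : X) :
    map (fun δ : PathsFrom x => δ.1 1) (𝓝 (const x)) = 𝓝 x := by
  have eval_continuous : Continuous fun δ : PathsFrom x => δ.1 1 := by fun_prop
  refine le_antisymm (eval_continuous.tendsto (const x)) fun S hS => ?_
  rw [mem_map, nhds_subtype_eq_comap] at hS
  obtain ⟨U, hU, hUS⟩ := ((hasBasis_nhds_continuousMap_const x).comap _).mem_iff.1 hS
  refine mem_of_superset (pathComponentIn_mem_nhds hU) fun y ⟨γ, hγ⟩ => ?_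
  simpa using @hUS ⟨γ.toContinuousMap, γ.source⟩ hγ

end Space

section TopologicalGroup

variable {G : Type*} [Group G] [TopologicalSpace G] [IsTopologicalGroup G]

theorem hasBasis_nhds (δ : PathsFrom (1 : G)) :
    (𝓝 δ).HasBasis (· ∈ 𝓝 (1 : G)) fun V => {ε | ∀ t, (δ.1 t)⁻¹ * ε.1 t ∈ V} := by
  have translate : comap (δ.1⁻¹ * ·) (𝓝 1) = 𝓝 δ.1 := by
    simpa [Homeomorph.mulLeft_symm] using (Homeomorph.mulLeft δ.1⁻¹).comap_nhds_eq 1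
  rw [nhds_subtype_eq_comap, ← translate]
  exact ((hasBasis_nhds_continuousMap_const (1 : G)).comap _).comap _

/-- The initial segments of `δ⁻¹ ε` stay in every neighbourhood of `1` that contains this path, and
join it to the constant path. -/
instance : LocallyPathConnectedSpace (PathsFrom (1 : G)) := by
  refine .of_bases hasBasis_nhds fun δ V hV => ⟨δ, fun t => ?_, fun {ε} hε => ?_⟩
  · simpa using mem_of_mem_nhds hV
  let quotient : PathsFrom (1 : G) := ⟨δ.1⁻¹ * ε.1, by simp [δ.2, ε.2]⟩
  let contraction (t : I) : PathsFrom (1 : G) :=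
    ⟨δ.1 * (initialSegment t quotient).1, by simp [δ.2, (initialSegment t quotient).2]⟩
  have contraction_continuous : Continuous contraction := by
    have : Continuous fun t => initialSegment t quotient :=
      continuous_initialSegment.comp (.prodMk_left quotient)
    exact .subtype_mk (continuous_const.mul (continuous_subtype_val.comp this)) _
  refine ⟨⟨⟨contraction, contraction_continuous⟩, ?_, ?_⟩, fun t s => ?_⟩
  · ext s
    simp [contraction]
  · ext s
    simp [contraction, quotient]
  · simpa [contraction, quotient] using hε (s * t)

end TopologicalGroup

end PathsFrom

section Fibration

variable {E X : Type u} [TopologicalSpace E] [TopologicalSpace X] {p : C(E, X)}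

theorem HasUniquePathLifting.endpoint_eq (hp : HasUniquePathLifting p) {e e₁ e₂ : E}
    (c : Path e e₁) (d : Path e e₂) (h : ∀ t, p (c t) = p (d t)) : e₁ = e₂ := by
  have c_eq_d := hp c.toContinuousMap d.toContinuousMap (by simp) (ContinuousMap.ext h)
  simpa using DFunLike.congr_fun c_eq_d 1

theorem HasUniquePathLifting.eq_of_forall_apply_eq (hp : HasUniquePathLifting p) {Y : Type*}
    [TopologicalSpace Y] [PathConnectedSpace Y] {g g' : Y → E} (hg : Continuous g)
    (hg' : Continuous g') {y₀ : Y} (h₀ : g y₀ = g' y₀) (h : ∀ y, p (g y) = p (g' y)) (y : Y) :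
    g y = g' y :=
  let γ := PathConnectedSpace.somePath y₀ y
  hp.endpoint_eq (γ.map hg) ((γ.map hg').cast h₀ rfl) fun t => h (γ t)

/-- The definition of a fibration only tests spaces `Y` in the universe of `E` and `X`. It suffices
to test the mapping path space `{(e, δ) | δ 0 = p e}`, from which all lifting problems are pulled
back. -/
theorem IsFibration.exists_homotopy_lift (hp : IsFibration p) {Y : Type*} [TopologicalSpace Y]
    (f : C(Y, E)) (F : C(I × Y, X)) (h : ∀ y, F (0, y) = p (f y)) :
    ∃ L : C(I × Y, E), (∀ y, L (0, y) = f y) ∧ ∀ z, p (L z) = F z := by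
  obtain ⟨Λ, hΛ₀, hΛ⟩ := hp {w : E × C(I, X) // w.2 0 = p w.1} ⟨fun w => w.1.1, by fun_prop⟩
    ⟨fun z => z.2.1.2 z.1, by fun_prop⟩ Subtype.property
  let pathFamily : C(Y, C(I, X)) := (F.comp .prodSwap).curry
  let classify : C(Y, {w : E × C(I, X) // w.2 0 = p w.1}) :=
    ⟨fun y => ⟨(f y, pathFamily y), h y⟩, by fun_prop⟩
  exact ⟨Λ.comp (.prodMap (.id I) classify), fun y => hΛ₀ _,
    fun z => DFunLike.congr_fun hΛ (z.1, classify z.2)⟩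

theorem IsFibration.exists_path_lift (hp : IsFibration p) {x x' : X} (γ : Path x x') {e : E}
    (he : p e = x) : ∃ (e' : E) (c : Path e e'), ∀ t, p (c t) = γ t := by
  obtain ⟨L, hL₀, hL⟩ := hp.exists_homotopy_lift (.const Unit e) (γ.toContinuousMap.comp .fst)
    (by simp [he])
  exact ⟨L (1, ()), ⟨⟨fun t => L (t, ()), by fun_prop⟩, hL₀ (), rfl⟩, fun t => hL (t, ())⟩

theorem IsFibration.surjective (hp : IsFibration p) [Nonempty E] [PathConnectedSpace X] :
    Function.Surjective p := by
  intro x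
  let e : E := Classical.arbitrary E
  obtain ⟨e', c, hc⟩ := hp.exists_path_lift (PathConnectedSpace.somePath (p e) x) rfl
  exact ⟨e', by simpa using hc 1⟩

theorem IsRigidCoveringFibration.exists_path_lift_of_homotopic (hp : IsRigidCoveringFibration p)
    {e e' : E} (c : Path e e') {γ : Path (p e) (p e')} (h : (c.map p.continuous).Homotopic γ) :
    ∃ d : Path e e', ∀ t, p (d t) = γ t := by
  obtain ⟨H⟩ := h
  obtain ⟨L, hL₀, hL⟩ := hp.fibration.exists_homotopy_lift c.toContinuousMap
    H.toHomotopy.toContinuousMap (fun t => H.apply_zero t)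
  have source_fixed : L (1, 0) = e :=
    hp.uniquePathLifting.endpoint_eq ⟨⟨fun t => L (t, 0), by fun_prop⟩, by simp [hL₀], rfl⟩
      (Path.refl e) fun t => (hL _).trans (H.source t)
  have target_fixed : L (1, 1) = e' :=
    hp.uniquePathLifting.endpoint_eq ⟨⟨fun t => L (t, 1), by fun_prop⟩, by simp [hL₀], rfl⟩
      (Path.refl e') fun t => (hL _).trans (H.target t)
  exact ⟨⟨⟨fun t => L (1, t), by fun_prop⟩, source_fixed, target_fixed⟩,
    fun t => (hL _).trans (H.apply_one t)⟩

end Fibration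

section LiftingCriterion

variable {E X : Type u} [TopologicalSpace E] [TopologicalSpace X] {p : C(E, X)}
  {Y : Type*} [TopologicalSpace Y] {f : C(Y, X)} {y₀ : Y} {e₀ : E}

/-- The fibre product of `Y` and `E` over `X`, as a subset of `Y × E`. A path in it is a path in `Y`
together with a lift through `p` of its image under `f`. -/
def fiberProduct (f : C(Y, X)) (p : C(E, X)) : Set (Y × E) := {z | p z.2 = f z.1}

/-- Every lift through `p`, starting at `e₀`, of the image under `f` of a loop at `y₀` is a loop.
This is the condition `f_* π₁(Y, y₀) ⊆ p_* π₁(E, e₀)` of the lifting criterion in terms of paths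
instead of homotopy classes. -/
def LiftsLoopsToLoops (p : C(E, X)) (f : C(Y, X)) (y₀ : Y) (e₀ : E) : Prop :=
  ∀ (γ : Path y₀ y₀) (e : E) (c : Path e₀ e), (∀ t, p (c t) = f (γ t)) → e = e₀

theorem joinedIn_fiberProduct_iff {y y' : Y} {e e' : E} :
    JoinedIn (fiberProduct f p) (y, e) (y', e') ↔
      ∃ (γ : Path y y') (c : Path e e'), ∀ t, p (c t) = f (γ t) :=
  ⟨fun ⟨γ, hγ⟩ => ⟨γ.map continuous_fst, γ.map continuous_snd, hγ⟩,
    fun ⟨γ, c, h⟩ => ⟨γ.prod c, h⟩⟩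

theorem IsFibration.exists_joinedIn_fiberProduct [PathConnectedSpace Y] (hp : IsFibration p)
    (he₀ : p e₀ = f y₀) (y : Y) : ∃ e, JoinedIn (fiberProduct f p) (y₀, e₀) (y, e) := by
  let γ := PathConnectedSpace.somePath y₀ y
  obtain ⟨e, c, hc⟩ := hp.exists_path_lift (γ.map f.continuous) he₀
  exact ⟨e, joinedIn_fiberProduct_iff.2 ⟨γ, c, hc⟩⟩

/-- Let `γ` be the projection to `Y` of a path from `(y₀, e₀)` to `(y, e)`. A lift of its reverse
from `e'` ends at `e₀` because loops lift to loops, so backwards it is the lift of `γ` from `e₀`. -/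
theorem LiftsLoopsToLoops.eq_of_joinedIn_fiberProduct (hf : LiftsLoopsToLoops p f y₀ e₀)
    (hp : IsRigidCoveringFibration p) {y : Y} {e e' : E}
    (h : JoinedIn (fiberProduct f p) (y₀, e₀) (y, e))
    (h' : JoinedIn (fiberProduct f p) (y₀, e₀) (y, e')) : e = e' := by
  obtain ⟨γ, c, hc⟩ := joinedIn_fiberProduct_iff.1 h
  obtain ⟨e'', d, hd⟩ := hp.fibration.exists_path_lift (γ.symm.map f.continuous) h'.target_mem
  have joined : JoinedIn (fiberProduct f p) (y₀, e₀) (y₀, e'') :=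
    h'.trans (joinedIn_fiberProduct_iff.2 ⟨γ.symm, d, hd⟩)
  obtain ⟨loop, c', hc'⟩ := joinedIn_fiberProduct_iff.1 joined
  obtain rfl : e'' = e₀ := hf loop e'' c' hc'
  exact hp.uniquePathLifting.endpoint_eq c d.symm fun t => by simp [hc, hd]

/-- Lifting the tautological homotopy on the space of paths from `y` extends `g` from `y` along all
paths at once; near `y` the endpoints of short paths cover a neighbourhood. -/
theorem IsFibration.continuousAt_of_forall_joinedIn_fiberProduct [LocallyPathConnectedSpace Y]
    (hp : IsFibration p) {g : Y → E} {y : Y} (hy : p (g y) = f y)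
    (hg : ∀ y' e', JoinedIn (fiberProduct f p) (y, g y) (y', e') → g y' = e') :
    ContinuousAt g y := by
  obtain ⟨L, hL₀, hL⟩ := hp.exists_homotopy_lift (.const (PathsFrom y) (g y))
    ⟨fun z => f (z.2.1 z.1), by fun_prop⟩ (fun δ => by simp [δ.2, hy])
  have g_eval_one (δ : PathsFrom y) : g (δ.1 1) = L (1, δ) :=
    hg _ _ (joinedIn_fiberProduct_iff.2 ⟨⟨δ.1, δ.2, rfl⟩,
      ⟨⟨fun t => L (t, δ), by fun_prop⟩, hL₀ δ, rfl⟩, fun t => hL (t, δ)⟩)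
  have continuous_g_eval_one : Continuous fun δ : PathsFrom y => g (δ.1 1) := by
    simp only [g_eval_one]
    fun_prop
  rw [ContinuousAt, ← PathsFrom.map_eval_one_nhds_const, tendsto_map'_iff]
  exact continuous_g_eval_one.tendsto (PathsFrom.const y)

theorem IsRigidCoveringFibration.exists_lift [PathConnectedSpace Y] [LocallyPathConnectedSpace Y]
    (hp : IsRigidCoveringFibration p) (he₀ : p e₀ = f y₀) (hf : LiftsLoopsToLoops p f y₀ e₀) :
    ∃ g : C(Y, E), g y₀ = e₀ ∧ ∀ y, p (g y) = f y := by
  choose g hg using hp.fibration.exists_joinedIn_fiberProduct (f := f) he₀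
  have g_eq {y : Y} {e : E} (h : JoinedIn (fiberProduct f p) (y₀, e₀) (y, e)) : g y = e :=
    hf.eq_of_joinedIn_fiberProduct hp (hg y) h
  have p_g (y : Y) : p (g y) = f y := (hg y).target_mem
  have g_continuous : Continuous g := continuous_iff_continuousAt.2 fun y =>
    hp.fibration.continuousAt_of_forall_joinedIn_fiberProduct (p_g y)
      fun _ _ h => g_eq ((hg y).trans h)
  exact ⟨⟨g, g_continuous⟩, g_eq (.refl he₀), p_g⟩

theorem IsRigidCoveringFibration.liftsLoopsToLoops (hp : IsRigidCoveringFibration p)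
    (hf : f y₀ = p e₀)
    (h : (FundamentalGroup.mapOfEq f hf).range ≤ (FundamentalGroup.map p e₀).range) :
    LiftsLoopsToLoops p f y₀ e₀ := by
  intro γ e c hc
  obtain ⟨a, ha⟩ := h ⟨FundamentalGroup.fromPath ⟦γ⟧, rfl⟩
  obtain ⟨loop, rfl⟩ := Path.Homotopic.Quotient.mk_surjective a
  rw [FundamentalGroup.mapOfEq_apply] at ha
  have homotopic : (loop.map p.continuous).Homotopic ((γ.map f.continuous).cast hf.symm hf.symm) :=
    Path.Homotopic.Quotient.exact ha
  obtain ⟨d, hd⟩ := hp.exists_path_lift_of_homotopic loop homotopic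
  exact hp.uniquePathLifting.endpoint_eq c d fun t => (hc t).trans (hd t).symm

theorem IsRigidCoveringFibration.hasUniqueLiftingProperty (hp : IsRigidCoveringFibration p)
    (e₀ : E) : HasUniqueLiftingProperty p e₀ := by
  intro Y _ _ _ y₀ f hf h
  have : PathConnectedSpace Y := .of_locallyPathConnectedSpace
  obtain ⟨g, hg₀, hg⟩ := hp.exists_lift hf.symm (hp.liftsLoopsToLoops hf h)
  refine ⟨g, ⟨hg₀, ContinuousMap.ext hg⟩, fun g' ⟨hg'₀, hg'⟩ => ContinuousMap.ext ?_⟩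
  exact hp.uniquePathLifting.eq_of_forall_apply_eq g'.continuous g.continuous
    (hg'₀.trans hg₀.symm) fun y => (DFunLike.congr_fun hg' y).trans (hg y).symm

end LiftingCriterion

section GeneralizedCoveringGroup

theorem HasUniqueLiftingProperty.existsUnique_lift {E X : Type u} [TopologicalSpace E]
    [TopologicalSpace X] {p : C(E, X)} {e₀ : E} (hp : HasUniqueLiftingProperty p e₀) {Y : Type u}
    [TopologicalSpace Y] [SimplyConnectedSpace Y] [LocallyPathConnectedSpace Y]
    {y₀ : Y} (f : C(Y, X)) (hf : f y₀ = p e₀) :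
    ∃! g : C(Y, E), g y₀ = e₀ ∧ p.comp g = f := by
  refine hp Y y₀ f hf ?_
  rintro _ ⟨a, rfl⟩
  rw [Subsingleton.elim a 1, map_one]
  exact one_mem _

variable {E G : Type u} [TopologicalSpace E] [Group G] [TopologicalSpace G]

/-- The homotopy `F` is `f` times a homotopy of paths issuing from `1`, and these are lifted by the
lift `Φ` of the endpoint map. -/
theorem HasUniqueLiftingProperty.isFibration [IsTopologicalGroup G] [Monoid E] [ContinuousMul E]
    {p : E →ₜ* G} (hp : HasUniqueLiftingProperty (p : C(E, G)) 1) :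
    IsFibration (p : C(E, G)) := by
  obtain ⟨Φ, ⟨hΦ₁, hΦ⟩, -⟩ := hp.existsUnique_lift (y₀ := PathsFrom.const (1 : G))
    ⟨fun δ => δ.1 1, by fun_prop⟩ (by simp)
  have p_Φ (δ : PathsFrom (1 : G)) : p (Φ δ) = δ.1 1 := DFunLike.congr_fun hΦ δ
  intro Y _ f F hF
  have p_continuous : Continuous p := p.continuous_toFun
  let track (z : I × Y) : PathsFrom (1 : G) :=
    ⟨⟨fun s => (p (f z.2))⁻¹ * F (s * z.1, z.2), by fun_prop⟩, by simp [hF]⟩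
  have track_continuous : Continuous track := by
    refine .subtype_mk (ContinuousMap.continuous_of_continuous_uncurry _ ?_) _
    change Continuous fun w : (I × Y) × I => (p (f w.1.2))⁻¹ * F (w.2 * w.1.1, w.1.2)
    fun_prop
  have track_zero (y : Y) : track (0, y) = PathsFrom.const 1 := by
    ext s
    simp [track, hF]
  refine ⟨⟨fun z => f z.2 * Φ (track z), by fun_prop⟩, fun y => ?_, ?_⟩
  · simp [track_zero, hΦ₁]
  · ext z
    simp [p_Φ, track]

/-- Both `α ↦ α 1` and `α ↦ Φ (p ∘ α)`, where `Φ` lifts the endpoint map of `G`, lift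
`α ↦ p (α 1)`. -/
theorem HasUniqueLiftingProperty.apply_one_eq [IsTopologicalGroup G] [Group E]
    [IsTopologicalGroup E] {p : E →ₜ* G} (hp : HasUniqueLiftingProperty (p : C(E, G)) 1)
    {α β : PathsFrom (1 : E)} (h : (p : C(E, G)).comp α.1 = (p : C(E, G)).comp β.1) :
    α.1 1 = β.1 1 := by
  obtain ⟨Φ, ⟨hΦ₁, hΦ⟩, -⟩ := hp.existsUnique_lift (y₀ := PathsFrom.const (1 : G))
    ⟨fun δ => δ.1 1, by fun_prop⟩ (by simp)
  let push : C(PathsFrom (1 : E), PathsFrom (1 : G)) :=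
    ⟨fun α => ⟨(p : C(E, G)).comp α.1, by simp [α.2]⟩, by fun_prop⟩
  let endpoint : C(PathsFrom (1 : E), E) := ⟨fun α => α.1 1, by fun_prop⟩
  have push_const : push (PathsFrom.const 1) = PathsFrom.const 1 := by
    ext t
    simp [push]
  have endpoint_eq : endpoint = Φ.comp push := by
    refine (hp.existsUnique_lift (y₀ := PathsFrom.const (1 : E))
      ((p : C(E, G)).comp endpoint) (by simp [endpoint])).unique ⟨rfl, rfl⟩ ⟨?_, ?_⟩
    · simp [push_const, hΦ₁]
    · rw [← ContinuousMap.comp_assoc, hΦ]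
      rfl
  have push_eq : push α = push β := Subtype.ext h
  calc α.1 1 = Φ (push α) := DFunLike.congr_fun endpoint_eq α
    _ = Φ (push β) := by rw [push_eq]
    _ = β.1 1 := (DFunLike.congr_fun endpoint_eq β).symm

theorem HasUniqueLiftingProperty.hasUniquePathLifting [IsTopologicalGroup G] [Group E]
    [IsTopologicalGroup E] {p : E →ₜ* G} (hp : HasUniqueLiftingProperty (p : C(E, G)) 1) :
    HasUniquePathLifting (p : C(E, G)) := by
  intro a b hab hpab
  have p_eq (t : I) : p (a t) = p (b t) := DFunLike.congr_fun hpab t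
  let α : PathsFrom (1 : E) := ⟨⟨fun t => (a 0)⁻¹ * a t, by fun_prop⟩, by simp⟩
  let β : PathsFrom (1 : E) := ⟨⟨fun t => (a 0)⁻¹ * b t, by fun_prop⟩, by simp [hab]⟩
  ext t
  have segment_eq := hp.apply_one_eq (α := PathsFrom.initialSegment t α)
    (β := PathsFrom.initialSegment t β) (by ext s; simp [α, β, p_eq])
  simpa [α, β] using segment_eq

theorem isGeneralizedCoveringGroup_iff [IsTopologicalGroup G] [Group E] [IsTopologicalGroup E]
    (p : E →ₜ* G) :
    IsGeneralizedCoveringGroup p ↔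
      ConnectedSpace E ∧ LocallyPathConnectedSpace E ∧
        IsRigidCoveringFibration (p : C(E, G)) :=
  ⟨fun h => ⟨h.connected, h.locPathConnected,
    h.uniqueLifting.isFibration, h.uniqueLifting.hasUniquePathLifting⟩,
   fun ⟨h₁, h₂, h₃⟩ => ⟨h₁, h₂, h₃.hasUniqueLiftingProperty 1⟩⟩

end GeneralizedCoveringGroup

section LiftedGroupStructure

variable {E : Type u} [TopologicalSpace E] {e₀ : E}

/-- Compare `c` with the diagonal of a lift of `(s, t) ↦ p (a s) * p (b t)`, which has sides `a` and
`b`. -/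
theorem IsRigidCoveringFibration.endpoint_eq_of_apply_eq_mul {M : Type u} [MulOneClass M]
    [TopologicalSpace M] [ContinuousMul M] {p : C(E, M)} (hp : IsRigidCoveringFibration p)
    (he₀ : p e₀ = 1) (a : Path e₀ e₀) {e e' : E} (b : Path e₀ e) (c : Path e₀ e')
    (h : ∀ t, p (c t) = p (a t) * p (b t)) : e' = e := by
  obtain ⟨L, hL₀, hL⟩ := hp.fibration.exists_homotopy_lift b.toContinuousMap
    ⟨fun z => p (a z.1) * p (b z.2), by fun_prop⟩ (fun t => by simp [he₀])
  have corner : L (1, 0) = e₀ :=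
    hp.uniquePathLifting.endpoint_eq ⟨⟨fun t => L (t, 0), by fun_prop⟩, by simp [hL₀], rfl⟩ a
      fun t => by simp [hL, he₀]
  have opposite_corner : L (1, 1) = e :=
    hp.uniquePathLifting.endpoint_eq ⟨⟨fun t => L (1, t), by fun_prop⟩, corner, rfl⟩ b
      fun t => by simp [hL, he₀]
  exact hp.uniquePathLifting.endpoint_eq c
    ⟨⟨fun t => L (t, t), by fun_prop⟩, by simp [hL₀], opposite_corner⟩
    fun t => (h t).trans (hL (t, t)).symm

variable [PathConnectedSpace E] [LocallyPathConnectedSpace E]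

theorem IsRigidCoveringFibration.exists_mul_lift {M : Type u} [MulOneClass M]
    [TopologicalSpace M] [ContinuousMul M] {p : C(E, M)} (hp : IsRigidCoveringFibration p)
    (he₀ : p e₀ = 1) :
    ∃ m : C(E × E, E), m (e₀, e₀) = e₀ ∧ ∀ x y, p (m (x, y)) = p x * p y := by
  obtain ⟨m, hm₀, hm⟩ := hp.exists_lift (f := ⟨fun z : E × E => p z.1 * p z.2, by fun_prop⟩)
    (y₀ := (e₀, e₀)) (e₀ := e₀) (by simp [he₀]) fun γ e c hc =>
      hp.endpoint_eq_of_apply_eq_mul he₀ (γ.map continuous_fst) (γ.map continuous_snd) c hc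
  exact ⟨m, hm₀, fun x y => hm (x, y)⟩

variable {G : Type u} [Group G] [TopologicalSpace G] [IsTopologicalGroup G] {p : C(E, G)}

theorem IsRigidCoveringFibration.exists_inv_lift (hp : IsRigidCoveringFibration p)
    (he₀ : p e₀ = 1) : ∃ i : C(E, E), i e₀ = e₀ ∧ ∀ x, p (i x) = (p x)⁻¹ :=
  hp.exists_lift (f := ⟨fun x => (p x)⁻¹, by fun_prop⟩) (by simp [he₀]) fun γ e c hc =>
    (hp.endpoint_eq_of_apply_eq_mul he₀ γ c (Path.refl e₀) fun t => by simp [hc, he₀]).symm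

theorem IsRigidCoveringFibration.exists_group (hp : IsRigidCoveringFibration p) (he₀ : p e₀ = 1) :
    ∃ (_ : Group E) (_ : IsTopologicalGroup E) (q : E →ₜ* G), (q : C(E, G)) = p := by
  obtain ⟨m, hm₀, hm⟩ := hp.exists_mul_lift he₀
  obtain ⟨i, hi₀, hi⟩ := hp.exists_inv_lift he₀
  have one_mul : ∀ x, m (e₀, x) = x :=
    hp.uniquePathLifting.eq_of_forall_apply_eq (by fun_prop) continuous_id hm₀
      fun x => by simp [hm, he₀]
  have inv_mul : ∀ x, m (i x, x) = e₀ :=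
    hp.uniquePathLifting.eq_of_forall_apply_eq (y₀ := e₀) (by fun_prop) continuous_const
      (by simp [hi₀, hm₀]) fun x => by simp [hm, hi, he₀]
  have mul_assoc (x y z : E) : m (m (x, y), z) = m (x, m (y, z)) :=
    hp.uniquePathLifting.eq_of_forall_apply_eq
      (g := fun w : E × E × E => m (m (w.1, w.2.1), w.2.2))
      (g' := fun w => m (w.1, m (w.2.1, w.2.2))) (y₀ := (e₀, e₀, e₀)) (by fun_prop) (by fun_prop)
      (by simp [hm₀]) (fun w => by simp [hm, mul_assoc]) (x, y, z)
  let : Mul E := ⟨fun x y => m (x, y)⟩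
  let : Inv E := ⟨i⟩
  let : One E := ⟨e₀⟩
  let : Group E := .ofLeftAxioms mul_assoc one_mul inv_mul
  have : IsTopologicalGroup E :=
    { continuous_mul := m.continuous
      continuous_inv := i.continuous }
  exact ⟨inferInstance, this,
    { toFun := p, map_one' := he₀, map_mul' := hm, continuous_toFun := p.continuous }, rfl⟩

end LiftedGroupStructure

end GenCov

theorem mainTheorem8_general {G : Type u} [Group G] [TopologicalSpace G] [IsTopologicalGroup G]
    [PathConnectedSpace G] :
    (∀ (E : Type u) [Group E] [TopologicalSpace E] [IsTopologicalGroup E] (p : E →ₜ* G),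
      GenCov.IsGeneralizedCoveringGroup p ↔
        ConnectedSpace E ∧ LocallyPathConnectedSpace E ∧
          GenCov.IsRigidCoveringFibration (p : C(E, G))) ∧
    (∀ (E : Type u) [TopologicalSpace E] (p : C(E, G)),
      (∃ (_ : Group E) (_ : IsTopologicalGroup E) (q : E →ₜ* G),
          (q : C(E, G)) = p ∧ GenCov.IsGeneralizedCoveringGroup q) ↔
        ConnectedSpace E ∧ LocallyPathConnectedSpace E ∧
          GenCov.IsRigidCoveringFibration p) := by
  refine ⟨fun E _ _ _ p => GenCov.isGeneralizedCoveringGroup_iff p, fun E _ p => ⟨?_, ?_⟩⟩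
  · rintro ⟨_, _, q, rfl, hq⟩
    exact (GenCov.isGeneralizedCoveringGroup_iff q).1 hq
  · rintro ⟨connected, locallyPathConnected, hp⟩
    have : PathConnectedSpace E := .of_locallyPathConnectedSpace
    obtain ⟨e₀, he₀⟩ := hp.fibration.surjective 1
    obtain ⟨_, _, q, rfl⟩ := hp.exists_group he₀
    exact ⟨_, _, q, rfl, (GenCov.isGeneralizedCoveringGroup_iff q).2
      ⟨connected, locallyPathConnected, hp⟩⟩

theorem mainTheorem8 {G : Type u} [Group G] [TopologicalSpace G] [IsTopologicalGroup G]
    [ConnectedSpace G] [LocallyPathConnectedSpace G] :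
    (∀ (E : Type u) [Group E] [TopologicalSpace E] [IsTopologicalGroup E] (p : E →ₜ* G),
      GenCov.IsGeneralizedCoveringGroup p ↔
        ConnectedSpace E ∧ LocallyPathConnectedSpace E ∧
          GenCov.IsRigidCoveringFibration (p : C(E, G))) ∧
    (∀ (E : Type u) [TopologicalSpace E] (p : C(E, G)),
      (∃ (_ : Group E) (_ : IsTopologicalGroup E) (q : E →ₜ* G),
          (q : C(E, G)) = p ∧ GenCov.IsGeneralizedCoveringGroup q) ↔
        ConnectedSpace E ∧ LocallyPathConnectedSpace E ∧
          GenCov.IsRigidCoveringFibration p) := by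
  have : PathConnectedSpace G := .of_locallyPathConnectedSpace
  exact mainTheorem8_general
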